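/- Let $\mathbf{W}^*$ be the category whose objects are the Archimedean real vector lattices $A$ with a distinguished strong unit $1_A \ge 0$ (for each $a\in A$ there is $n\in\mathbb{N}$ with $|a|\le n1_A$) and whose morphisms are the unit-preserving vector lattice homomorphisms. An essential embedding is an injective morphism $f\colon A\to B$ such that every morphism $g$ out of $B$ with $g\circ f$ injective is itself injective. For $A\in\mathbf{W}^*$ let $YA$ be the Yosida space of $A$, that is, the compact Hausdorff space of all ideals of $A$ maximal with respect to not containing $1_A$, with the hull-kernel topology. Let $\nu_A\colon A\to C(YA)$ be the Yosida embedding, where $\nu_A(a)(P)$ is the unique real $r$ with $a-r1_A\in P$. The uniform completion operator $u$ assigns to $A$ the object $uA=C(YA)$ (with unit the constant function $1$) and the morphism $u_A=\nu_A$. For $H\in\mathbf{W}^*$ consider the pairs $(A,f)$ with $A\in\mathbf{W}^*$ and $f\colon A\to H$ an essential embedding, preordered by $(A_1,f_1)\le(A_2,f_2)$ if and only if there is an essential embedding $g\colon A_1\to A_2$ with $f_1=f_2\circ g$; pass to the associated poset of equivalence classes. Let $\mathcal{V}(H,u)=\{A\in\mathbf{W}^*: uA=H\}$ be the subposet of the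 classes of those pairs $(A,f)$ for which there is an isomorphism $\theta\colon uA\to H$ of $\mathbf{W}^*$ with $\theta\circ u_A=f$. Let $K$ be a compact Hausdorff space. Then $\mathcal{V}(C(K),u)$ has a minimum if and only if $K$ is zero-dimensional (that is, its clopen sets form a base). In that case the minimum is the class of $F(K)=\{f\in C(K): f(K)\text{ is finite}\}$ with its inclusion into $C(K)$. -/

import Mathlib

universe v

/-- An object of `W*`: an Archimedean (real) vector lattice with a distinguished strong unit. -/
structure WStar : Type (v + 1) where
  carrier : Type v
  [addCommGroup : AddCommGroup carrier]
  [lattice : Lattice carrier]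
  [isOrderedAddMonoid : IsOrderedAddMonoid carrier]
  [module : Module ℝ carrier]
  [posSMulMono : PosSMulMono ℝ carrier]
  archimedean : ∀ a b : carrier, (∀ n : ℕ, n • a ≤ b) → a ≤ 0
  unit : carrier
  unit_nonneg : 0 ≤ unit
  unit_strong : ∀ a : carrier, ∃ n : ℕ, |a| ≤ n • unit

namespace WStar

instance : CoeSort WStar.{v} (Type v) := ⟨WStar.carrier⟩

attribute [instance] addCommGroup lattice isOrderedAddMonoid module posSMulMono

/-- A morphism of `W*`: a unit-preserving vector lattice homomorphism. -/
@[ext]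
structure Hom (A B : WStar.{v}) where
  toFun : A → B
  map_add : ∀ x y, toFun (x + y) = toFun x + toFun y
  map_smul : ∀ (r : ℝ) x, toFun (r • x) = r • toFun x
  map_sup : ∀ x y, toFun (x ⊔ y) = toFun x ⊔ toFun y
  map_inf : ∀ x y, toFun (x ⊓ y) = toFun x ⊓ toFun y
  map_unit : toFun A.unit = B.unit

instance (A B : WStar.{v}) : CoeFun (Hom A B) (fun _ => A → B) := ⟨Hom.toFun⟩

/-- The identity morphism. -/
def Hom.id (A : WStar.{v}) : Hom A A where
  toFun := fun x => x
  map_add _ _ := rfl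
  map_smul _ _ := rfl
  map_sup _ _ := rfl
  map_inf _ _ := rfl
  map_unit := rfl

/-- The composition `g ∘ f`. -/
def Hom.comp {A B C : WStar.{v}} (g : Hom B C) (f : Hom A B) : Hom A C where
  toFun := fun x => g (f x)
  map_add x y := by rw [f.map_add, g.map_add]
  map_smul r x := by rw [f.map_smul, g.map_smul]
  map_sup x y := by rw [f.map_sup, g.map_sup]
  map_inf x y := by rw [f.map_inf, g.map_inf]
  map_unit := by rw [f.map_unit, g.map_unit]

/-- An isomorphism of `W*`. -/
def Hom.IsIso {A B : WStar.{v}} (f : Hom A B) : Prop :=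
  ∃ g : Hom B A, g.comp f = Hom.id A ∧ f.comp g = Hom.id B

/-- An essential embedding of `W*`: an injective morphism `f : A → B` such that each morphism `g`
out of `B` for which `g ∘ f` is injective is itself injective. -/
def Hom.IsEssential {A B : WStar.{v}} (f : Hom A B) : Prop :=
  Function.Injective f ∧
    ∀ (C : WStar.{v}) (g : Hom B C), Function.Injective (g.comp f) → Function.Injective g

theorem Hom.isEssential_id (A : WStar.{v}) : (Hom.id A).IsEssential :=
  ⟨fun _ _ h => h, fun _ _ h => h⟩

theorem Hom.IsEssential.comp {A B C : WStar.{v}} {g : Hom B C} {f : Hom A B}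
    (hg : g.IsEssential) (hf : f.IsEssential) : (g.comp f).IsEssential :=
  ⟨hg.1.comp hf.1, fun D k hk => hg.2 D k (hf.2 D (k.comp g) hk)⟩

/-! ### The objects `C(X)` and `F(X)` -/

section ContinuousFunctions

variable (X : Type v) [TopologicalSpace X]

/-- `C(X)` for a compact space `X`, with the constant function `1` as the strong unit. -/
def contFun [CompactSpace X] : WStar.{v} where
  carrier := C(X, ℝ)
  posSMulMono := ⟨fun r hr f g hfg x => by
    simpa using mul_le_mul_of_nonneg_left (hfg x) hr⟩
  archimedean f g h x := by
    by_contra hx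
    have hx' : 0 < f x := not_le.mp hx
    obtain ⟨n, hn⟩ := exists_lt_nsmul hx' (g x)
    exact absurd (by simpa using h n x) (not_le.mpr (by simpa using hn))
  unit := 1
  unit_nonneg := fun _ => zero_le_one
  unit_strong f := by
    obtain ⟨n, hn⟩ := exists_nat_ge ‖f‖
    refine ⟨n, fun x => ?_⟩
    have h := (f.norm_coe_le_norm x).trans hn
    simpa using h

/-- The continuous real functions on `X` with finite range, as a linear subspace of `C(X)`. -/
def finRangeSubmodule : Submodule ℝ C(X, ℝ) where
  carrier := {f | (Set.range f).Finite}
  add_mem' {f g} hf hg := by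
    refine (hf.image2 (fun a b : ℝ => a + b) hg).subset ?_
    rintro _ ⟨x, rfl⟩
    exact ⟨f x, ⟨x, rfl⟩, g x, ⟨x, rfl⟩, rfl⟩
  zero_mem' := by
    refine (Set.finite_singleton (0 : ℝ)).subset ?_
    rintro _ ⟨x, rfl⟩
    rfl
  smul_mem' r f hf := by
    refine (hf.image (fun a : ℝ => r * a)).subset ?_
    rintro _ ⟨x, rfl⟩
    exact ⟨f x, ⟨x, rfl⟩, rfl⟩

theorem finRange_sup ⦃f g : C(X, ℝ)⦄ (hf : f ∈ finRangeSubmodule X)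
    (hg : g ∈ finRangeSubmodule X) : f ⊔ g ∈ finRangeSubmodule X := by
  refine (Set.Finite.image2 (fun a b : ℝ => a ⊔ b) hf hg).subset ?_
  rintro _ ⟨x, rfl⟩
  exact ⟨f x, ⟨x, rfl⟩, g x, ⟨x, rfl⟩, rfl⟩

theorem finRange_inf ⦃f g : C(X, ℝ)⦄ (hf : f ∈ finRangeSubmodule X)
    (hg : g ∈ finRangeSubmodule X) : f ⊓ g ∈ finRangeSubmodule X := by
  refine (Set.Finite.image2 (fun a b : ℝ => a ⊓ b) hf hg).subset ?_
  rintro _ ⟨x, rfl⟩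
  exact ⟨f x, ⟨x, rfl⟩, g x, ⟨x, rfl⟩, rfl⟩

theorem finRange_one : (1 : C(X, ℝ)) ∈ finRangeSubmodule X := by
  refine (Set.finite_singleton (1 : ℝ)).subset ?_
  rintro _ ⟨x, rfl⟩
  rfl

/-- The pointwise lattice structure on the functions with finite range. -/
instance finRangeLattice : Lattice (finRangeSubmodule X) :=
  Subtype.lattice (finRange_sup X) (finRange_inf X)

/-- `F(X) = {f ∈ C(X) : f(X) is finite}`, with the operations and the unit of `C(X)`. -/
def finRange [CompactSpace X] : WStar.{v} where
  carrier := finRangeSubmodule X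
  isOrderedAddMonoid :=
    { add_le_add_left := fun f g h k => (contFun X).isOrderedAddMonoid.add_le_add_left f.1 g.1 h k.1 }
  posSMulMono := ⟨fun r hr f g hfg => (contFun X).posSMulMono.smul_le_smul_of_nonneg_left hr hfg⟩
  archimedean f g h := (contFun X).archimedean f.1 g.1 h
  unit := ⟨1, finRange_one X⟩
  unit_nonneg := (contFun X).unit_nonneg
  unit_strong f := (contFun X).unit_strong f.1

/-- The inclusion `F(X) → C(X)`. -/
def finRangeIncl [CompactSpace X] : Hom (finRange X) (contFun X) where
  toFun f := f.1
  map_add _ _ := rfl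
  map_smul _ _ := rfl
  map_sup _ _ := rfl
  map_inf _ _ := rfl
  map_unit := rfl

end ContinuousFunctions

/-! ### The Yosida space and the Yosida embedding -/

/-- An ideal of a vector lattice: a solid linear subspace. -/
def IsIdeal {A : WStar.{v}} (I : Submodule ℝ A) : Prop :=
  ∀ x y : A, |x| ≤ |y| → y ∈ I → x ∈ I

/-- The ideals that are maximal with respect to not containing the distinguished unit. -/
def IsUnitMaximal {A : WStar.{v}} (P : Submodule ℝ A) : Prop :=
  IsIdeal P ∧ A.unit ∉ P ∧ ∀ I : Submodule ℝ A, IsIdeal I → A.unit ∉ I → P ≤ I → I = P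

/-- The underlying set of the Yosida space `YA`. -/
def Yosida (A : WStar.{v}) : Type v := {P : Submodule ℝ A // IsUnitMaximal P}

/-- The hull-kernel topology: generated by the complements of the hulls `{P | a ∈ P}`. -/
instance (A : WStar.{v}) : TopologicalSpace (Yosida A) :=
  TopologicalSpace.generateFrom {U | ∃ a : A, U = {P | a ∉ P.1}}

section Basics

variable {A : WStar.{v}}

theorem abs_smul_le (r : ℝ) (x : A) : |r • x| ≤ |r| • |x| := by
  have key : ∀ (s : ℝ) (y : A), s • y ≤ |s| • |y| := by
    intro s y
    rcases le_total 0 s with hs | hs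
    · rw [abs_of_nonneg hs]
      exact smul_le_smul_of_nonneg_left (le_abs_self y) hs
    · rw [abs_of_nonpos hs]
      have : s • y = (-s) • (-y) := by simp
      rw [this]
      exact smul_le_smul_of_nonneg_left (neg_le_abs y) (neg_nonneg.mpr hs)
  refine abs_le'.mpr ⟨key r x, ?_⟩
  have h := key (-r) x
  rwa [neg_smul, abs_neg] at h

theorem smul_le_smul_right' {s t : ℝ} (h : s ≤ t) {x : A} (hx : 0 ≤ x) : s • x ≤ t • x := by
  have : 0 ≤ (t - s) • x := smul_nonneg (sub_nonneg.mpr h) hx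
  rw [sub_smul] at this
  exact sub_nonneg.mp this

theorem IsIdeal.abs_mem {I : Submodule ℝ A} (hI : IsIdeal I) {x : A} (hx : x ∈ I) : |x| ∈ I :=
  hI _ x (by rw [abs_abs]) hx

theorem IsIdeal.mem_of_le {I : Submodule ℝ A} (hI : IsIdeal I) {x y : A} (h : |x| ≤ y)
    (hy : y ∈ I) : x ∈ I :=
  hI x y (h.trans (le_abs_self y)) hy

/-- The ideal generated by an ideal `I` and an element `x`. -/
def adjoin (I : Submodule ℝ A) (x : A) : Submodule ℝ A where
  carrier := {b | ∃ p ∈ I, ∃ t : ℝ, 0 ≤ t ∧ |b| ≤ p + t • |x|}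
  zero_mem' := ⟨0, I.zero_mem, 0, le_rfl, by simp⟩
  add_mem' {b c} hb hc := by
    obtain ⟨p, hp, s, hs, h1⟩ := hb
    obtain ⟨q, hq, t, ht, h2⟩ := hc
    refine ⟨p + q, I.add_mem hp hq, s + t, add_nonneg hs ht, ?_⟩
    refine (abs_add_le b c).trans ((add_le_add h1 h2).trans_eq ?_)
    rw [add_smul]; abel
  smul_mem' r b hb := by
    obtain ⟨p, hp, s, hs, h1⟩ := hb
    refine ⟨|r| • p, I.smul_mem _ hp, |r| * s, mul_nonneg (abs_nonneg r) hs, ?_⟩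
    refine (abs_smul_le r b).trans ?_
    refine (smul_le_smul_of_nonneg_left h1 (abs_nonneg r)).trans_eq ?_
    rw [smul_add, mul_smul]

theorem adjoin_isIdeal (I : Submodule ℝ A) (x : A) : IsIdeal (adjoin I x) := by
  rintro b c hbc ⟨p, hp, t, ht, h⟩
  exact ⟨p, hp, t, ht, hbc.trans h⟩

theorem le_adjoin {I : Submodule ℝ A} (hI : IsIdeal I) (x : A) : I ≤ adjoin I x :=
  fun p hp => ⟨|p|, hI.abs_mem hp, 0, le_rfl, by simp⟩

theorem mem_adjoin (I : Submodule ℝ A) (x : A) : x ∈ adjoin I x :=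
  ⟨0, I.zero_mem, 1, zero_le_one, by simp⟩

/-- If `x` is not in the unit-maximal ideal `P`, then the unit lies below `p + t|x|` for some
`p ∈ P` and `t > 0`. -/
theorem IsUnitMaximal.exists_le {P : Submodule ℝ A} (hP : IsUnitMaximal P) {x : A} (hx : x ∉ P) :
    ∃ p ∈ P, ∃ t : ℝ, 0 < t ∧ A.unit ≤ p + t • |x| := by
  have h : A.unit ∈ adjoin P x := by
    by_contra hu
    have := hP.2.2 _ (adjoin_isIdeal P x) hu (le_adjoin hP.1 x)
    exact hx (this ▸ mem_adjoin P x)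
  obtain ⟨p, hp, t, ht, h⟩ := h
  refine ⟨p, hp, t + 1, by linarith, (le_abs_self _).trans (h.trans ?_)⟩
  exact add_le_add le_rfl (smul_le_smul_right' (by linarith) (abs_nonneg x))

theorem IsUnitMaximal.posPart_mem_or {P : Submodule ℝ A} (hP : IsUnitMaximal P) (z : A) :
    z ⊔ 0 ∈ P ∨ (-z) ⊔ 0 ∈ P := by
  by_contra hcon
  rw [not_or] at hcon
  obtain ⟨p, hp, s, hs, h1⟩ := hP.exists_le hcon.1
  obtain ⟨q, hq, t, ht, h2⟩ := hP.exists_le hcon.2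
  rw [abs_of_nonneg le_sup_right] at h1 h2
  set w := A.unit - |p| - |q| with hw
  have hr : 0 < s + t := by linarith
  have h1' : w ≤ (s + t) • (z ⊔ 0) := by
    have e1 : A.unit ≤ |p| + (s + t) • (z ⊔ 0) :=
      h1.trans (add_le_add (le_abs_self p) (smul_le_smul_right' (by linarith) le_sup_right))
    have e2 : A.unit - |p| ≤ (s + t) • (z ⊔ 0) := sub_le_iff_le_add'.mpr e1
    exact (sub_le_self _ (abs_nonneg q)).trans e2
  have h2' : w ≤ (s + t) • ((-z) ⊔ 0) := by
    have e1 : A.unit ≤ |q| + (s + t) • ((-z) ⊔ 0) :=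
      h2.trans (add_le_add (le_abs_self q) (smul_le_smul_right' (by linarith) le_sup_right))
    have e2 : A.unit - |q| ≤ (s + t) • ((-z) ⊔ 0) := sub_le_iff_le_add'.mpr e1
    rw [hw, sub_right_comm]
    exact (sub_le_self _ (abs_nonneg p)).trans e2
  have scale : ∀ y : A, w ≤ (s + t) • y → (s + t)⁻¹ • w ≤ y := by
    intro y hy
    have := smul_le_smul_of_nonneg_left hy (inv_nonneg.mpr hr.le)
    rwa [smul_smul, inv_mul_cancel₀ hr.ne', one_smul] at this
  have h3 : (s + t)⁻¹ • w ≤ 0 := by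
    refine (le_inf (scale _ h1') (scale _ h2')).trans_eq ?_
    exact posPart_inf_negPart_eq_zero z
  have h4 : w ≤ 0 := by
    have := smul_le_smul_of_nonneg_left h3 hr.le
    rwa [smul_smul, mul_inv_cancel₀ hr.ne', one_smul, smul_zero] at this
  have h5 : A.unit ≤ |p| + |q| := by
    rw [hw, sub_sub] at h4
    exact sub_nonpos.mp h4
  apply hP.2.1
  refine hP.1.mem_of_le ?_ (P.add_mem (hP.1.abs_mem hp) (hP.1.abs_mem hq))
  rwa [abs_of_nonneg A.unit_nonneg]

/-- Modulo a unit-maximal ideal each element is a real multiple of the unit. -/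
theorem IsUnitMaximal.exists_real {P : Submodule ℝ A} (hP : IsUnitMaximal P) (a : A) :
    ∃ r : ℝ, a - r • A.unit ∈ P := by
  obtain ⟨n, hn⟩ := A.unit_strong a
  have hn' : |a| ≤ (n : ℝ) • A.unit := by rwa [Nat.cast_smul_eq_nsmul]
  set S : Set ℝ := {s | (s • A.unit - a) ⊔ 0 ∈ P} with hS
  have hne : (-(n : ℝ)) ∈ S := by
    have : (-(n : ℝ)) • A.unit - a ≤ 0 := by
      rw [neg_smul, sub_eq_add_neg]
      have : -a ≤ (n : ℝ) • A.unit := (neg_le_abs a).trans hn'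
      have := sub_nonpos.mpr this
      rwa [sub_eq_add_neg, add_comm] at this
    rw [hS, Set.mem_ofPred_eq, sup_eq_right.mpr this]
    exact P.zero_mem
  have hbd : ∀ s ∈ S, s ≤ (n : ℝ) := by
    intro s hs
    by_contra hlt
    have hlt : 0 < s - n := by linarith [not_le.mp hlt]
    have h1 : (s - n) • A.unit ≤ (s • A.unit - a) ⊔ 0 := by
      refine le_trans ?_ le_sup_left
      rw [sub_smul]
      exact sub_le_sub_left ((le_abs_self a).trans hn') _
    have h2 : (s - n) • A.unit ∈ P := by
      refine hP.1.mem_of_le ?_ hs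
      rwa [abs_of_nonneg (smul_nonneg hlt.le A.unit_nonneg)]
    have h3 := P.smul_mem (s - n)⁻¹ h2
    rw [smul_smul, inv_mul_cancel₀ hlt.ne', one_smul] at h3
    exact hP.2.1 h3
  have hbdd : BddAbove S := ⟨n, hbd⟩
  set r := sSup S with hr
  refine ⟨r, ?_⟩
  -- both one-sided errors are at most `ε` modulo `P`
  have key : ∀ ε : ℝ, 0 < ε → ∃ p ∈ P, |a - r • A.unit| ≤ p + ε • A.unit := by
    intro ε hε
    obtain ⟨s, hsS, hs⟩ := exists_lt_of_lt_csSup ⟨_, hne⟩ (show r - ε < sSup S by linarith)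
    have hnot : r + ε ∉ S := fun h => by linarith [le_csSup hbdd h]
    have hup : (-((r + ε) • A.unit - a)) ⊔ 0 ∈ P :=
      (hP.posPart_mem_or ((r + ε) • A.unit - a)).resolve_left hnot
    refine ⟨_, P.add_mem hsS hup, abs_le'.mpr ⟨?_, ?_⟩⟩
    · have e1 : a - r • A.unit = -((r + ε) • A.unit - a) + ε • A.unit := by
        rw [add_smul]; abel
      rw [e1]
      gcongr
      exact le_sup_left.trans (le_add_of_nonneg_left le_sup_right)
    · have e1 : -(a - r • A.unit) = (s • A.unit - a) + (r - s) • A.unit := by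
        rw [sub_smul]; abel
      rw [e1]
      exact add_le_add (le_sup_left.trans (le_add_of_nonneg_right le_sup_right))
        (smul_le_smul_right' (by linarith) A.unit_nonneg)
  by_contra hx
  obtain ⟨p, hp, t, ht, h1⟩ := hP.exists_le hx
  obtain ⟨q, hq, h2⟩ := key (1 / (2 * t)) (by positivity)
  have h3 : A.unit ≤ p + t • q + (1 / 2 : ℝ) • A.unit := by
    refine h1.trans ?_
    have := smul_le_smul_of_nonneg_left h2 ht.le
    rw [smul_add, smul_smul, show t * (1 / (2 * t)) = 1 / 2 by field_simp] at this
    rw [add_assoc]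
    gcongr
  have h4 : (1 / 2 : ℝ) • A.unit ≤ p + t • q := by
    have e : A.unit = (1 / 2 : ℝ) • A.unit + (1 / 2 : ℝ) • A.unit := by
      rw [← add_smul]; norm_num
    have h5 := sub_le_iff_le_add.mpr h3
    have e' : A.unit - (1 / 2 : ℝ) • A.unit = (1 / 2 : ℝ) • A.unit := by
      rw [sub_eq_iff_eq_add]; exact e
    rwa [e'] at h5
  have h6 : (1 / 2 : ℝ) • A.unit ∈ P := by
    refine hP.1.mem_of_le ?_ (P.add_mem hp (P.smul_mem t hq))
    rwa [abs_of_nonneg (smul_nonneg (by norm_num) A.unit_nonneg)]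
  have h7 := P.smul_mem 2 h6
  rw [smul_smul] at h7
  norm_num at h7
  exact hP.2.1 h7

/-- The value `a(P)`: the real number `r` such that `a ≡ r • unit` modulo `P`. -/
noncomputable def value (a : A) (P : Yosida A) : ℝ := (P.2.exists_real a).choose

theorem value_spec (a : A) (P : Yosida A) : a - value a P • A.unit ∈ P.1 :=
  (P.2.exists_real a).choose_spec

theorem value_unique {a : A} {P : Yosida A} {r : ℝ} (h : a - r • A.unit ∈ P.1) :
    value a P = r := by
  by_contra hne
  have h1 := P.1.sub_mem h (value_spec a P)
  have e : a - r • A.unit - (a - value a P • A.unit) = (value a P - r) • A.unit := by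
    rw [sub_smul]; abel
  rw [e] at h1
  have h2 := P.1.smul_mem (value a P - r)⁻¹ h1
  rw [smul_smul, inv_mul_cancel₀ (sub_ne_zero.mpr hne), one_smul] at h2
  exact P.2.2.1 h2

theorem value_add (a b : A) (P : Yosida A) : value (a + b) P = value a P + value b P := by
  apply value_unique
  have := P.1.add_mem (value_spec a P) (value_spec b P)
  convert this using 1
  rw [add_smul]; abel

theorem value_smul (r : ℝ) (a : A) (P : Yosida A) : value (r • a) P = r * value a P := by
  apply value_unique
  have := P.1.smul_mem r (value_spec a P)
  rwa [smul_sub, smul_smul] at this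

theorem value_unit (P : Yosida A) : value A.unit P = 1 := by
  apply value_unique
  simp

theorem value_neg (a : A) (P : Yosida A) : value (-a) P = -value a P := by
  have := value_smul (-1) a P
  simpa using this

theorem value_eq_zero_iff (a : A) (P : Yosida A) : value a P = 0 ↔ a ∈ P.1 := by
  constructor
  · intro h
    have := value_spec a P
    rwa [h, zero_smul, sub_zero] at this
  · intro h
    exact value_unique (by simpa using h)

theorem value_posPart (a : A) (P : Yosida A) : value (a ⊔ 0) P = value a P ⊔ 0 := by
  have hx := P.2.1.abs_mem (value_spec a P)
  apply value_unique
  have e : (value a P ⊔ 0) • A.unit = (value a P • A.unit) ⊔ 0 := by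
    rcases le_total 0 (value a P) with h | h
    · rw [sup_eq_left.mpr h, sup_eq_left.mpr (smul_nonneg h A.unit_nonneg)]
    · rw [sup_eq_right.mpr h, zero_smul, sup_eq_right.mpr]
      have := smul_le_smul_right' h A.unit_nonneg
      rwa [zero_smul] at this
  rw [e]
  exact P.2.1.mem_of_le (abs_sup_sub_sup_le_abs _ _ _) hx

theorem value_sup (a b : A) (P : Yosida A) : value (a ⊔ b) P = value a P ⊔ value b P := by
  have e : a ⊔ b = (a - b) ⊔ 0 + b := by
    rw [sup_add, sub_add_cancel, zero_add]
  rw [e, value_add, value_posPart, sub_eq_add_neg, value_add, value_neg, ← sub_eq_add_neg,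
    sup_add, sub_add_cancel, zero_add]

theorem value_inf (a b : A) (P : Yosida A) : value (a ⊓ b) P = value a P ⊓ value b P := by
  have e : a ⊓ b = -((-a) ⊔ (-b)) := by rw [neg_sup, neg_neg, neg_neg]
  rw [e, value_neg, value_sup, value_neg, value_neg, neg_sup, neg_neg, neg_neg]

theorem isOpen_lt_value (a : A) (r : ℝ) : IsOpen {P : Yosida A | r < value a P} := by
  have e : {P : Yosida A | r < value a P} =
      {P : Yosida A | (a - r • A.unit) ⊔ 0 ∉ P.1} := by
    ext P
    simp only [Set.mem_ofPred_eq]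
    rw [← value_eq_zero_iff, value_posPart, sup_eq_right, not_le, sub_eq_add_neg, value_add,
      value_neg, value_smul, value_unit]
    constructor <;> intro h <;> linarith
  rw [e]
  exact TopologicalSpace.isOpen_generateFrom_of_mem ⟨_, rfl⟩

theorem continuous_value (a : A) : Continuous (value a) := by
  rw [continuous_iff_lower_upperSemicontinuous]
  constructor
  · rw [lowerSemicontinuous_iff_isOpen_preimage]
    exact fun r => isOpen_lt_value a r
  · rw [upperSemicontinuous_iff_isOpen_preimage]
    intro r
    have := isOpen_lt_value (-a) (-r)
    simp only [value_neg, neg_lt_neg_iff] at this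
    exact this

/-- Each ideal that omits the unit lies in a unit-maximal ideal. -/
theorem exists_unitMaximal {I : Submodule ℝ A} (hI : IsIdeal I) (hu : A.unit ∉ I) :
    ∃ P : Yosida A, I ≤ P.1 := by
  obtain ⟨P, hIP, hP⟩ := zorn_le_nonempty₀ {J : Submodule ℝ A | IsIdeal J ∧ A.unit ∉ J}
    (by
      intro c hc hchain J hJ
      have hne : c.Nonempty := ⟨J, hJ⟩
      have hdir : DirectedOn (· ≤ ·) c := hchain.directedOn
      refine ⟨sSup c, ⟨?_, ?_⟩, fun _ h => le_sSup h⟩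
      · intro x y hxy hy
        obtain ⟨J', hJ', hy⟩ := (Submodule.mem_sSup_of_directed hne hdir).mp hy
        exact (Submodule.mem_sSup_of_directed hne hdir).mpr ⟨J', hJ', (hc hJ').1 x y hxy hy⟩
      · intro h
        obtain ⟨J', hJ', h⟩ := (Submodule.mem_sSup_of_directed hne hdir).mp h
        exact (hc hJ').2 h)
    I ⟨hI, hu⟩
  exact ⟨⟨P, hP.prop.1, hP.prop.2, fun J hJ hJu hle =>
    le_antisymm (hP.le_of_ge ⟨hJ, hJu⟩ hle) hle⟩, hIP⟩

end Basics

instance (A : WStar.{v}) : CompactSpace (Yosida A) := by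
  constructor
  refine isCompact_generateFrom rfl ?_
  intro Q hQ hcov
  -- the ideal generated by the elements whose sets occur in the cover
  let S : Set A := {a | {P : Yosida A | a ∉ P.1} ∈ Q}
  let I : Submodule ℝ A :=
    { carrier := {b | ∃ s : Finset A, ↑s ⊆ S ∧ ∃ t : ℝ, 0 ≤ t ∧ |b| ≤ t • ∑ a ∈ s, |a|}
      zero_mem' := ⟨∅, by simp, 0, le_rfl, by simp⟩
      add_mem' := by
        classical
        rintro b c ⟨s, hs, x, hx, h1⟩ ⟨t, ht, y, hy, h2⟩
        refine ⟨s ∪ t, by simp [hs, ht], x + y, add_nonneg hx hy, ?_⟩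
        refine (abs_add_le b c).trans ?_
        rw [add_smul]
        refine add_le_add (h1.trans ?_) (h2.trans ?_)
        · exact smul_le_smul_of_nonneg_left (Finset.sum_le_sum_of_subset_of_nonneg
            Finset.subset_union_left (fun _ _ _ => abs_nonneg _)) hx
        · exact smul_le_smul_of_nonneg_left (Finset.sum_le_sum_of_subset_of_nonneg
            Finset.subset_union_right (fun _ _ _ => abs_nonneg _)) hy
      smul_mem' := by
        rintro r b ⟨s, hs, x, hx, h1⟩
        refine ⟨s, hs, |r| * x, mul_nonneg (abs_nonneg r) hx, ?_⟩
        rw [mul_smul]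
        exact (abs_smul_le r b).trans (smul_le_smul_of_nonneg_left h1 (abs_nonneg r)) }
  have hI : IsIdeal I := by
    rintro b c hbc ⟨s, hs, t, ht, h⟩
    exact ⟨s, hs, t, ht, hbc.trans h⟩
  have hu : A.unit ∈ I := by
    by_contra hu
    obtain ⟨P, hP⟩ := exists_unitMaximal hI hu
    obtain ⟨U, hU, hPU⟩ := hcov (Set.mem_univ P)
    obtain ⟨a, rfl⟩ := hQ hU
    refine hPU (hP ⟨{a}, by simpa [S] using hU, 1, zero_le_one, by simp⟩)
  obtain ⟨s, hs, t, ht, h⟩ := hu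
  refine ⟨(fun a : A => {P : Yosida A | a ∉ P.1}) '' s, ?_, s.finite_toSet.image _, ?_⟩
  · rintro _ ⟨a, ha, rfl⟩
    exact hs ha
  · intro P _
    by_contra hcon
    apply P.2.2.1
    refine P.2.1.mem_of_le h (P.1.smul_mem t (P.1.sum_mem fun a ha => P.2.1.abs_mem ?_))
    by_contra haP
    exact hcon ⟨_, ⟨a, ha, rfl⟩, haP⟩

/-- The Yosida embedding `ν_A : A → C(YA)`. -/
noncomputable def yosidaMap (A : WStar.{v}) : Hom A (contFun (Yosida A)) where
  toFun a := ContinuousMap.mk (value a) (continuous_value a)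
  map_add a b := ContinuousMap.ext fun P => value_add a b P
  map_smul r a := ContinuousMap.ext fun P => value_smul r a P
  map_sup a b := ContinuousMap.ext fun P => value_sup a b P
  map_inf a b := ContinuousMap.ext fun P => value_inf a b P
  map_unit := ContinuousMap.ext fun P => value_unit P

/-! ### Operators and the poset `V(H, h)` -/

/-- An operator on `W*`: it assigns to each `A` an object `hA` and a morphism `h_A : A → hA`. -/
structure Operator where
  obj : WStar.{v} → WStar.{v}
  map : ∀ A, Hom A (obj A)

/-- The uniform completion operator: `uA = C(YA)` and `u_A = ν_A`. -/
noncomputable def uniformCompletion : Operator.{v} where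
  obj A := contFun (Yosida A)
  map A := yosidaMap A

/-- The pairs `(A, f)` where `f : A → H` is an essential embedding. -/
structure EssSub (H : WStar.{v}) where
  obj : WStar.{v}
  map : Hom obj H
  essential : map.IsEssential

/-- `(A₁, f₁) ≤ (A₂, f₂)` when `f₁ = f₂ ∘ f` for some essential embedding `f : A₁ → A₂`. -/
instance (H : WStar.{v}) : Preorder (EssSub H) where
  le A B := ∃ f : Hom A.obj B.obj, f.IsEssential ∧ A.map = B.map.comp f
  le_refl A := ⟨Hom.id _, Hom.isEssential_id _, rfl⟩
  le_trans A B C := by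
    rintro ⟨f, hf, h1⟩ ⟨g, hg, h2⟩
    exact ⟨g.comp f, hg.comp hf, by rw [h1, h2]; rfl⟩

/-- The poset of equivalence classes of pairs `(A, f)` with `f : A → H` an essential embedding. -/
abbrev SubPoset (H : WStar.{v}) : Type (v + 1) :=
  Antisymmetrization (EssSub H) (fun A B => A ≤ B)

/-- The class of a pair `(A, f)`. -/
def EssSub.cls {H : WStar.{v}} (A : EssSub H) : SubPoset H :=
  toAntisymmetrization (fun A B => A ≤ B) A

/-- `V(H, h) = {A : hA = H}`: the classes of the pairs `(A, f)` that are `(A, h_A)` up to an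
isomorphism between `hA` and `H`. -/
def V (H : WStar.{v}) (h : Operator.{v}) : Set (SubPoset H) :=
  {c | ∃ A : EssSub H, A.cls = c ∧
    ∃ θ : Hom (h.obj A.obj) H, θ.IsIso ∧ θ.comp (h.map A.obj) = A.map}

end WStar

/-- A zero-dimensional space: the clopen sets form a base. -/
def IsZeroDimensional (X : Type v) [TopologicalSpace X] : Prop :=
  TopologicalSpace.IsTopologicalBasis {U : Set X | IsClopen U}

/-! The members of `V(C(K), u)` are the classes of the embeddings `f : A → C(K)` whose image
separates the points of `K`. By the lattice form of Stone–Weierstrass such an image is uniformly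
dense, which makes `f` essential (`Hom.Separates.isEssential_of_comp`) and identifies `K` with the
Yosida space of `A` through evaluations (`Hom.Separates.exists_iso`). Conversely, the image of `ν_A`
separates points, hence is dense, and density survives an isomorphism of completions
(`Hom.separates_of_iso`).

If `K` is zero-dimensional, `F(K)` separates points. Every separating image contains the indicators
of clopen sets, because a close approximant can be rescaled and truncated to the exact indicator
(`Hom.Separates.exists_indicator`). Hence it contains `F(K)`, which is therefore the minimum.

For the converse, the functions constant near a given point `p` form a separating sublattice
(`constNearIncl_separates`). A minimum lies below all of these, as `p` varies, so it consists of
locally constant functions. Their fibres are clopen and separate points. -/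

namespace WStar

/-! ### Pointwise values, density and essential embeddings -/

section Evaluation

variable {K : Type v} [TopologicalSpace K] [CompactSpace K] {A B : WStar.{v}}

/-- The value at `x` of the function `f a`. -/
def Hom.ev (f : Hom A (contFun K)) (a : A) (x : K) : ℝ := (show C(K, ℝ) from f a) x

theorem Hom.ev_ext {f : Hom A (contFun K)} {g : Hom B (contFun K)} {a : A} {b : B}
    (h : ∀ x, f.ev a x = g.ev b x) : f a = g b :=
  ContinuousMap.ext h

theorem Hom.continuous_ev (f : Hom A (contFun K)) (a : A) : Continuous (f.ev a) :=
  (show C(K, ℝ) from f a).continuous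

theorem Hom.ev_add (f : Hom A (contFun K)) (a b : A) (x : K) :
    f.ev (a + b) x = f.ev a x + f.ev b x :=
  congrArg (fun h : C(K, ℝ) => h x) (f.map_add a b)

theorem Hom.ev_smul (f : Hom A (contFun K)) (r : ℝ) (a : A) (x : K) :
    f.ev (r • a) x = r * f.ev a x :=
  congrArg (fun h : C(K, ℝ) => h x) (f.map_smul r a)

theorem Hom.ev_sup (f : Hom A (contFun K)) (a b : A) (x : K) :
    f.ev (a ⊔ b) x = f.ev a x ⊔ f.ev b x :=
  congrArg (fun h : C(K, ℝ) => h x) (f.map_sup a b)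

theorem Hom.ev_inf (f : Hom A (contFun K)) (a b : A) (x : K) :
    f.ev (a ⊓ b) x = f.ev a x ⊓ f.ev b x :=
  congrArg (fun h : C(K, ℝ) => h x) (f.map_inf a b)

theorem Hom.ev_unit (f : Hom A (contFun K)) (x : K) : f.ev A.unit x = 1 :=
  congrArg (fun h : C(K, ℝ) => h x) f.map_unit

theorem Hom.ev_zero (f : Hom A (contFun K)) (x : K) : f.ev 0 x = 0 := by
  simpa using f.ev_smul 0 0 x

theorem Hom.ev_neg (f : Hom A (contFun K)) (a : A) (x : K) : f.ev (-a) x = -f.ev a x := by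
  simpa using f.ev_smul (-1) a x

theorem Hom.ev_sub (f : Hom A (contFun K)) (a b : A) (x : K) :
    f.ev (a - b) x = f.ev a x - f.ev b x := by
  rw [sub_eq_add_neg, f.ev_add, f.ev_neg, sub_eq_add_neg]

theorem Hom.ev_abs (f : Hom A (contFun K)) (a : A) (x : K) : f.ev |a| x = |f.ev a x| := by
  rw [abs, f.ev_sup, f.ev_neg, abs]

theorem Hom.ev_sum (f : Hom A (contFun K)) {ι : Type*} (s : Finset ι) (a : ι → A) (x : K) :
    f.ev (∑ i ∈ s, a i) x = ∑ i ∈ s, f.ev (a i) x :=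
  map_sum (AddMonoidHom.mk' (fun a => f.ev a x) fun a b => f.ev_add a b x) a s

theorem Hom.ev_mono (f : Hom A (contFun K)) {a b : A} (h : a ≤ b) (x : K) :
    f.ev a x ≤ f.ev b x := by
  rw [← sup_eq_right.mpr h, f.ev_sup]
  exact le_sup_left

/-- An inequality is the equation `a ⊔ b = b`, so an injective lattice homomorphism reflects order.
-/
theorem Hom.le_of_ev_le {f : Hom A (contFun K)} (hf : Function.Injective f) {a b : A}
    (h : ∀ x, f.ev a x ≤ f.ev b x) : a ≤ b := by
  rw [← sup_eq_right]
  exact hf (Hom.ev_ext fun x => by rw [f.ev_sup, sup_eq_right.mpr (h x)])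

/-- The functions in the image of `f` separate the points of `K`. -/
def Hom.Separates (f : Hom A (contFun K)) : Prop :=
  ∀ x y : K, x ≠ y → ∃ a, f.ev a x ≠ f.ev a y

/-- The image of a separating morphism is uniformly dense. -/
theorem Hom.Separates.exists_approx {f : Hom A (contFun K)} (hf : f.Separates) (g : C(K, ℝ))
    {ε : ℝ} (hε : 0 < ε) : ∃ a, ∀ x, |f.ev a x - g x| < ε := by
  let L : Set C(K, ℝ) := Set.range fun a : A => (show C(K, ℝ) from f a)
  have hL : closure L = ⊤ := by
    refine ContinuousMap.sublattice_closure_eq_top L ⟨_, A.unit, rfl⟩ ?_ ?_ ?_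
    · rintro _ ⟨a, rfl⟩ _ ⟨b, rfl⟩
      exact ⟨a ⊓ b, f.map_inf a b⟩
    · rintro _ ⟨a, rfl⟩ _ ⟨b, rfl⟩
      exact ⟨a ⊔ b, f.map_sup a b⟩
    · intro v x y
      by_cases hxy : x = y
      · subst hxy
        refine ⟨_, ⟨v x • A.unit, rfl⟩, ?_, ?_⟩ <;>
        · change f.ev _ x = _
          rw [f.ev_smul, f.ev_unit, mul_one]
      · obtain ⟨a, ha⟩ := hf x y hxy
        have hd : f.ev a x - f.ev a y ≠ 0 := sub_ne_zero.mpr ha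
        -- The affine function of `a` that takes the prescribed values at `x` and `y`.
        refine ⟨_, ⟨((v x - v y) / (f.ev a x - f.ev a y)) • (a - f.ev a y • A.unit)
          + v y • A.unit, rfl⟩, ?_, ?_⟩
        · change f.ev _ x = _
          simp only [f.ev_add, f.ev_smul, f.ev_sub, f.ev_unit]
          field_simp
          ring
        · change f.ev _ y = _
          simp only [f.ev_add, f.ev_smul, f.ev_sub, f.ev_unit]
          ring
  have hg : g ∈ closure L := hL ▸ Set.mem_univ g
  obtain ⟨_, ⟨a, rfl⟩, ha⟩ := Metric.mem_closure_iff.mp hg ε hε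
  refine ⟨a, fun x => ?_⟩
  rw [abs_sub_comm]
  exact (ContinuousMap.dist_apply_le_dist x).trans_lt ha

/-- A function within `1/3` of a Urysohn function that is `0` at `x` and `1` at `y` still tells the
two points apart. -/
theorem Hom.separates_of_exists_approx [T2Space K] {f : Hom A (contFun K)}
    (hf : ∀ g : C(K, ℝ), ∃ a, ∀ x, |f.ev a x - g x| ≤ 1 / 3) : f.Separates := by
  intro x y hxy
  obtain ⟨g, hg0, hg1, -⟩ := exists_continuous_zero_one_of_isClosed
    (isClosed_singleton (x := x)) (isClosed_singleton (x := y)) (by simpa using hxy)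
  obtain ⟨a, ha⟩ := hf g
  refine ⟨a, fun h => ?_⟩
  have h0 : g x = 0 := hg0 rfl
  have h1 : g y = 1 := hg1 rfl
  have hx := abs_le.mp (ha x)
  have hy := abs_le.mp (ha y)
  rw [h0] at hx
  rw [h1] at hy
  linarith [hx.2, hy.1]

/-- A factor of a separating embedding through an embedding is essential. -/
theorem Hom.Separates.isEssential_of_comp {f : Hom A (contFun K)} (hf : f.Separates)
    (hinj : Function.Injective f) {h : Hom B (contFun K)} (hh : Function.Injective h)
    {g : Hom A B} (e : f = h.comp g) : g.IsEssential := by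
  have ev_g : ∀ a x, h.ev (g a) x = f.ev a x := fun a x => by rw [e]; rfl
  refine ⟨fun a b hab => hinj (by rw [e]; exact congrArg h hab), fun C k hk => ?_⟩
  have map_zero : k 0 = 0 := by simpa using k.map_smul 0 0
  have map_neg : ∀ b, k (-b) = -k b := fun b => by simpa using k.map_smul (-1) b
  -- If `k` kills `b ≠ 0`, density yields `c ≠ 0` in `A` with `0 ≤ g c ≤ |b|`. Then `k` kills `g c`,
  -- against the injectivity of `k ∘ g`.
  have kernel : ∀ b, k b = 0 → b = 0 := by
    intro b hb
    by_contra hne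
    have hx : ∃ x, h.ev b x ≠ 0 := by
      by_contra hcon
      push Not at hcon
      exact hne (hh (Hom.ev_ext fun x => by rw [hcon x, h.ev_zero]))
    obtain ⟨x, hx⟩ := hx
    have hpos : 0 < |h.ev b x| := abs_pos.mpr hx
    -- Lowering a `δ`-approximant of `|b|` by `δ` puts it below `|b|`, and at `x` it still exceeds
    -- `4δ - 2δ > 0`.
    set δ := |h.ev b x| / 4 with hδ
    have hδ0 : 0 < δ := by positivity
    obtain ⟨a, ha⟩ := hf.exists_approx (show C(K, ℝ) from h |b|) hδ0
    have ha' : ∀ y, abs (f.ev a y - |h.ev b y|) < δ := fun y => by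
      have := ha y
      change |f.ev a y - h.ev |b| y| < δ at this
      rwa [h.ev_abs] at this
    set c := (a - δ • A.unit) ⊔ 0 with hc
    have ev_c : ∀ y, f.ev c y = (f.ev a y - δ) ⊔ 0 := fun y => by
      rw [hc, f.ev_sup, f.ev_sub, f.ev_smul, f.ev_unit, f.ev_zero, mul_one]
    have hle : g c ≤ |b| := Hom.le_of_ev_le hh fun y => by
      rw [ev_g, ev_c, h.ev_abs]
      refine sup_le ?_ (abs_nonneg _)
      linarith [(abs_lt.mp (ha' y)).2]
    have hge : 0 ≤ g c := Hom.le_of_ev_le hh fun y => by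
      rw [ev_g, ev_c, h.ev_zero]
      exact le_sup_right
    have hkabs : k |b| = 0 := by
      rw [abs, k.map_sup, map_neg, hb, neg_zero, sup_idem]
    have hkc : k (g c) = 0 := by
      have h1 : k (g c) ⊔ 0 = 0 := by
        rw [← hkabs, ← k.map_sup, sup_eq_right.mpr hle]
      have h2 : k (g c) ⊔ 0 = k (g c) := by
        rw [← map_zero, ← k.map_sup, sup_eq_left.mpr hge]
      rw [← h2, h1]
    have hg0 : g 0 = 0 := by simpa using g.map_smul 0 0
    have hc0 : c = 0 := hk (show k (g c) = k (g 0) by rw [hkc, hg0, map_zero])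
    have := ev_c x
    rw [hc0, f.ev_zero] at this
    have h3 : f.ev a x - δ ≤ 0 := by rw [this]; exact le_sup_left
    have h4 := (abs_lt.mp (ha' x)).1
    linarith
  intro b c hbc
  rw [← sub_eq_zero]
  refine kernel _ ?_
  rw [sub_eq_add_neg, k.map_add, map_neg, hbc, add_neg_cancel]

theorem Hom.Separates.isEssential {f : Hom A (contFun K)} (hf : f.Separates)
    (hinj : Function.Injective f) : f.IsEssential :=
  hf.isEssential_of_comp hinj (h := Hom.id _) (fun _ _ h => h) rfl

/-- A morphism whose image lies in the image of an embedding factors through it. -/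
theorem Hom.exists_factor {H : WStar.{v}} {f : Hom A H} {h : Hom B H}
    (hh : Function.Injective h) (him : ∀ a, ∃ b, h b = f a) : ∃ g : Hom A B, f = h.comp g := by
  choose g hg using him
  refine ⟨⟨g, fun x y => hh ?_, fun r x => hh ?_, fun x y => hh ?_, fun x y => hh ?_, hh ?_⟩, ?_⟩
  · rw [hg, h.map_add, hg, hg, f.map_add]
  · rw [hg, h.map_smul, hg, f.map_smul]
  · rw [hg, h.map_sup, hg, hg, f.map_sup]
  · rw [hg, h.map_inf, hg, hg, f.map_inf]
  · rw [hg, h.map_unit, f.map_unit]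
  · exact Hom.ext (funext fun a => (hg a).symm)

end Evaluation

/-! ### Points of the Yosida space as evaluations -/

section YosidaSpace

variable {K : Type v} [TopologicalSpace K] [CompactSpace K] {A : WStar.{v}}

theorem yosida_ext {P Q : Yosida A} (h : ∀ a, value a P = value a Q) : P = Q :=
  Subtype.ext (Submodule.ext fun a => by rw [← value_eq_zero_iff, ← value_eq_zero_iff, h])

theorem yosidaMap_separates (A : WStar.{v}) : (yosidaMap A).Separates := by
  intro P Q hPQ
  by_contra hcon
  push Not at hcon
  exact hPQ (yosida_ext hcon)

instance (A : WStar.{v}) : T2Space (Yosida A) := by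
  refine T2Space.of_injective_continuous (f := fun (P : Yosida A) (a : A) => value a P) ?_ ?_
  · exact fun P Q h => yosida_ext fun a => congrFun h a
  · exact continuous_pi fun a => continuous_value a

/-- The ideal of the elements of `A` that vanish at `x`. -/
def Hom.vanishing (f : Hom A (contFun K)) (x : K) : Submodule ℝ A where
  carrier := {a | f.ev a x = 0}
  zero_mem' := f.ev_zero x
  add_mem' {a b} ha hb := by
    rw [Set.mem_ofPred_eq] at *
    rw [f.ev_add, ha, hb, add_zero]
  smul_mem' r a ha := by
    rw [Set.mem_ofPred_eq] at *
    rw [f.ev_smul, ha, mul_zero]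

theorem Hom.mem_vanishing {f : Hom A (contFun K)} {x : K} {a : A} :
    a ∈ f.vanishing x ↔ f.ev a x = 0 := Iff.rfl

theorem Hom.sub_mem_vanishing (f : Hom A (contFun K)) (x : K) (a : A) :
    a - f.ev a x • A.unit ∈ f.vanishing x := by
  rw [Hom.mem_vanishing, f.ev_sub, f.ev_smul, f.ev_unit, mul_one, sub_self]

/-- A larger ideal with an element `a` such that `a(x) ≠ 0` also contains `a - a(x) • 1`, hence a
nonzero multiple of the unit. -/
theorem Hom.vanishing_isUnitMaximal (f : Hom A (contFun K)) (x : K) :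
    IsUnitMaximal (f.vanishing x) := by
  refine ⟨fun a b hab hb => ?_, fun h => ?_, fun I hI hu hle => le_antisymm (fun a ha => ?_) hle⟩
  · have := f.ev_mono hab x
    rw [f.ev_abs, f.ev_abs, Hom.mem_vanishing.mp hb, abs_zero] at this
    exact abs_nonpos_iff.mp this
  · rw [Hom.mem_vanishing, f.ev_unit] at h
    exact one_ne_zero h
  · by_contra hne
    have h1 := I.sub_mem ha (hle (f.sub_mem_vanishing x a))
    rw [sub_sub_cancel] at h1
    exact hu ((I.smul_mem_iff hne).mp h1)

/-- The point of the Yosida space that is given by evaluation at `x`. -/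
def Hom.point (f : Hom A (contFun K)) (x : K) : Yosida A :=
  ⟨f.vanishing x, f.vanishing_isUnitMaximal x⟩

theorem Hom.value_point (f : Hom A (contFun K)) (x : K) (a : A) :
    value a (f.point x) = f.ev a x :=
  value_unique (f.sub_mem_vanishing x a)

theorem Hom.continuous_point (f : Hom A (contFun K)) : Continuous f.point := by
  refine continuous_generateFrom_iff.mpr ?_
  rintro _ ⟨a, rfl⟩
  exact isOpen_ne_fun (f.continuous_ev a) continuous_const

theorem Hom.Separates.injective_point {f : Hom A (contFun K)} (hf : f.Separates) :
    Function.Injective f.point := by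
  intro x y hxy
  by_contra hne
  obtain ⟨a, ha⟩ := hf x y hne
  exact ha (by rw [← f.value_point, ← f.value_point, hxy])

/-- If the elements of `P` had no common zero, compactness would give a finite sum of their absolute
values that is bounded below by some `ε > 0`, forcing the unit into `P`. So `P` lies in the
vanishing ideal of a point, and maximality gives equality. -/
theorem Hom.surjective_point {f : Hom A (contFun K)} (hf : Function.Injective f) :
    Function.Surjective f.point := by
  intro P
  suffices h : ∃ x, ∀ a ∈ P.1, f.ev a x = 0 by
    obtain ⟨x, hx⟩ := h
    refine ⟨x, Subtype.ext ?_⟩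
    exact P.2.2.2 _ (f.vanishing_isUnitMaximal x).1 (f.vanishing_isUnitMaximal x).2.1 hx
  by_contra hcon
  push Not at hcon
  obtain ⟨s, hs⟩ := isCompact_univ.elim_finite_subcover
    (fun a : P.1 => {x : K | f.ev a.1 x ≠ 0})
    (fun a => isOpen_ne_fun (f.continuous_ev a.1) continuous_const)
    (fun x _ => by
      obtain ⟨a, ha, hx⟩ := hcon x
      exact Set.mem_iUnion.mpr ⟨⟨a, ha⟩, hx⟩)
  set b : A := ∑ a ∈ s, |a.1| with hb
  have hbP : b ∈ P.1 := P.1.sum_mem fun a _ => P.2.1.abs_mem a.2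
  have hpos : ∀ x, 0 < f.ev b x := by
    intro x
    obtain ⟨a, has, hax⟩ := Set.mem_iUnion₂.mp (hs (Set.mem_univ x))
    rw [hb, f.ev_sum]
    refine Finset.sum_pos' (fun i _ => ?_) ⟨a, has, ?_⟩
    · rw [f.ev_abs]; exact abs_nonneg _
    · rw [f.ev_abs]; exact abs_pos.mpr hax
  have hε : ∃ ε > 0, ∀ x, ε ≤ f.ev b x := by
    rcases isEmpty_or_nonempty K with hK | hK
    -- On the empty space no minimum is attained, but any positive bound works.
    · exact ⟨1, one_pos, fun x => hK.elim x⟩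
    · obtain ⟨x, -, hx⟩ := isCompact_univ.exists_isMinOn Set.univ_nonempty
        (f.continuous_ev b).continuousOn
      exact ⟨f.ev b x, hpos x, fun y => hx (Set.mem_univ y)⟩
  obtain ⟨ε, hε, hle⟩ := hε
  have h1 : ε • A.unit ≤ b := Hom.le_of_ev_le hf fun x => by
    rw [f.ev_smul, f.ev_unit, mul_one]
    exact hle x
  have h2 : ε • A.unit ∈ P.1 := by
    refine P.2.1.mem_of_le ?_ hbP
    rwa [abs_of_nonneg (smul_nonneg hε.le A.unit_nonneg)]
  exact P.2.2.1 ((P.1.smul_mem_iff hε.ne').mp h2)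

/-- Composition with a continuous map. -/
def compHom {X : Type v} [TopologicalSpace X] [CompactSpace X] (φ : C(K, X)) :
    Hom (contFun X) (contFun K) where
  toFun g := (show C(X, ℝ) from g).comp φ
  map_add _ _ := rfl
  map_smul _ _ := rfl
  map_sup _ _ := rfl
  map_inf _ _ := rfl
  map_unit := rfl

/-- A separating embedding into `C(K)` is the uniform completion up to isomorphism. -/
theorem Hom.Separates.exists_iso {f : Hom A (contFun K)} (hf : f.Separates)
    (hinj : Function.Injective f) :
    ∃ θ : Hom (uniformCompletion.obj A) (contFun K),
      θ.IsIso ∧ θ.comp (uniformCompletion.map A) = f := by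
  -- A continuous bijection from a compact space onto a Hausdorff space.
  let e : K ≃ₜ Yosida A := f.continuous_point.homeoOfEquivCompactToT2
    (f := Equiv.ofBijective f.point ⟨hf.injective_point, Hom.surjective_point hinj⟩)
  refine ⟨compHom (e : C(K, Yosida A)), ⟨compHom (e.symm : C(Yosida A, K)), ?_, ?_⟩, ?_⟩
  · refine Hom.ext (funext fun g => ContinuousMap.ext fun P => ?_)
    exact congrArg (show C(Yosida A, ℝ) from g) (e.apply_symm_apply P)
  · refine Hom.ext (funext fun g => ContinuousMap.ext fun x => ?_)
    exact congrArg (show C(K, ℝ) from g) (e.symm_apply_apply x)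
  · exact Hom.ext (funext fun a => ContinuousMap.ext fun x => f.value_point x a)

/-- Unit-preserving lattice homomorphisms preserve bounds `|b| ≤ ε • 1`. An approximant in `C(YA)`
of the preimage of `g` is thus sent to an equally good approximant of `g`; it need not be known that
`θ` comes from a homeomorphism. -/
theorem Hom.separates_of_iso [T2Space K] {f : Hom A (contFun K)}
    {θ : Hom (uniformCompletion.obj A) (contFun K)} (hθ : θ.IsIso)
    (e : θ.comp (uniformCompletion.map A) = f) : f.Separates := by
  refine Hom.separates_of_exists_approx fun g => ?_
  obtain ⟨ψ, -, hψ⟩ := hθ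
  obtain ⟨a, ha⟩ := (yosidaMap_separates A).exists_approx (show C(Yosida A, ℝ) from ψ g)
    (show (0 : ℝ) < 1 / 3 by norm_num)
  refine ⟨a, fun x => ?_⟩
  let θ' : Hom (contFun (Yosida A)) (contFun K) := θ
  let c : contFun (Yosida A) := ψ g
  have hd : |yosidaMap A a - c| ≤ (1 / 3 : ℝ) • (contFun (Yosida A)).unit := by
    refine Hom.le_of_ev_le (f := Hom.id (contFun (Yosida A))) (fun _ _ h => h) fun P => ?_
    rw [Hom.ev_abs, Hom.ev_sub, Hom.ev_smul, Hom.ev_unit, mul_one]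
    exact (ha P).le
  have h1 := θ'.ev_mono hd x
  rw [θ'.ev_abs, θ'.ev_sub, θ'.ev_smul, θ'.ev_unit, mul_one] at h1
  have h2 : θ'.ev (yosidaMap A a) x = f.ev a x := by rw [← e]; rfl
  have h3 : θ'.ev c x = g x :=
    congrArg (fun k : Hom (contFun K) (contFun K) => k.ev g x) hψ
  rwa [h2, h3] at h1

end YosidaSpace

/-! ### Members of `V(C(K), u)` as separating embeddings -/

section Poset

variable {K : Type v} [TopologicalSpace K] [CompactSpace K]

/-- `V(C(K), u)` consists of the classes of the embeddings with separating image. -/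
theorem cls_mem_V {A : EssSub (contFun K)} (hA : A.map.Separates) :
    A.cls ∈ V (contFun K) uniformCompletion :=
  ⟨A, rfl, hA.exists_iso A.essential.1⟩

theorem exists_of_mem_V [T2Space K] {c : SubPoset (contFun K)}
    (hc : c ∈ V (contFun K) uniformCompletion) :
    ∃ A : EssSub (contFun K), A.cls = c ∧ A.map.Separates := by
  obtain ⟨A, hA, θ, hθ, e⟩ := hc
  exact ⟨A, hA, Hom.separates_of_iso hθ e⟩

theorem EssSub.cls_le_cls {H : WStar.{v}} {A B : EssSub H} : A.cls ≤ B.cls ↔ A ≤ B :=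
  toAntisymmetrization_le_toAntisymmetrization_iff

end Poset

/-! ### Functions constant near a point -/

section LocallyConstant

variable {K : Type v} [TopologicalSpace K] (p : K)

/-- The continuous functions that are constant near `p`. -/
def constNear : Submodule ℝ C(K, ℝ) where
  carrier := {f | ∀ᶠ x in nhds p, f x = f p}
  zero_mem' := Filter.Eventually.of_forall fun _ => rfl
  add_mem' hf hg := by
    filter_upwards [hf, hg] with x h1 h2
    simp [h1, h2]
  smul_mem' r f hf := by
    filter_upwards [hf] with x h1
    simp [h1]

theorem constNear_sup ⦃f g : C(K, ℝ)⦄ (hf : f ∈ constNear p) (hg : g ∈ constNear p) :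
    f ⊔ g ∈ constNear p := by
  filter_upwards [hf, hg] with x h1 h2
  simp [h1, h2]

theorem constNear_inf ⦃f g : C(K, ℝ)⦄ (hf : f ∈ constNear p) (hg : g ∈ constNear p) :
    f ⊓ g ∈ constNear p := by
  filter_upwards [hf, hg] with x h1 h2
  simp [h1, h2]

/-- The pointwise lattice structure on the functions that are constant near `p`. -/
instance constNearLattice : Lattice (constNear p) :=
  Subtype.lattice (constNear_sup p) (constNear_inf p)

variable [CompactSpace K]

/-- The functions that are constant near `p`, with the operations and the unit of `C(K)`. -/
def constNearObj : WStar.{v} where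
  carrier := constNear p
  isOrderedAddMonoid :=
    { add_le_add_left := fun f g h k => (contFun K).isOrderedAddMonoid.add_le_add_left f.1 g.1 h k.1 }
  posSMulMono := ⟨fun _ hr _ _ hfg => (contFun K).posSMulMono.smul_le_smul_of_nonneg_left hr hfg⟩
  archimedean f g h := (contFun K).archimedean f.1 g.1 h
  unit := ⟨1, Filter.Eventually.of_forall fun _ => rfl⟩
  unit_nonneg := (contFun K).unit_nonneg
  unit_strong f := (contFun K).unit_strong f.1

/-- The inclusion of the functions that are constant near `p`. -/
def constNearIncl : Hom (constNearObj p) (contFun K) where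
  toFun f := f.1
  map_add _ _ := rfl
  map_smul _ _ := rfl
  map_sup _ _ := rfl
  map_inf _ _ := rfl
  map_unit := rfl

/-- Of two distinct points one differs from `p`. A Urysohn function that is `0` there and `1`
outside a neighbourhood disjoint from a neighbourhood of `p` is constant near `p`; requiring the
value `1` at the other point as well makes it separate the two. -/
theorem constNearIncl_separates [T2Space K] : (constNearIncl p).Separates := by
  have key : ∀ x y : K, x ≠ y → x ≠ p → ∃ g ∈ constNear p, g x ≠ g y := by
    intro x y hxy hxp
    obtain ⟨U, W, hU, hW, hxU, hpW, hd⟩ := t2_separation hxp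
    obtain ⟨g, hg0, hg1, -⟩ := exists_continuous_zero_one_of_isClosed
      (isClosed_singleton (x := x)) (hU.isClosed_compl.union (isClosed_singleton (x := y)))
      (by
        rw [Set.disjoint_singleton_left]
        rintro (h | h)
        · exact h hxU
        · exact hxy h)
    have hgW : ∀ z ∈ W, g z = 1 := fun z hz =>
      hg1 (Or.inl fun hzU => Set.disjoint_left.mp hd hzU hz)
    refine ⟨g, ?_, ?_⟩
    · change ∀ᶠ z in nhds p, g z = g p
      filter_upwards [hW.mem_nhds hpW] with z hz
      rw [hgW z hz, hgW p hpW]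
    · have h0 : g x = 0 := hg0 rfl
      have h1 : g y = 1 := hg1 (Or.inr rfl)
      rw [h0, h1]
      exact zero_ne_one
  intro x y hxy
  by_cases hxp : x = p
  · obtain ⟨g, hg, hne⟩ := key y x hxy.symm fun h => hxy (hxp.trans h.symm)
    exact ⟨⟨g, hg⟩, hne.symm⟩
  · obtain ⟨g, hg, hne⟩ := key x y hxy hxp
    exact ⟨⟨g, hg⟩, hne⟩

theorem constNearIncl_injective : Function.Injective (constNearIncl p) :=
  fun _ _ h => Subtype.ext h

end LocallyConstant

/-! ### Clopen sets and the minimum -/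

section ZeroDimensional

variable {K : Type v} [TopologicalSpace K] [CompactSpace K]

theorem finRangeIncl_injective : Function.Injective (finRangeIncl K) :=
  fun _ _ h => Subtype.ext h

theorem finRangeIncl_separates [T2Space K] (hK : IsZeroDimensional K) :
    (finRangeIncl K).Separates := by
  classical
  intro x y hxy
  obtain ⟨U, hU, hxU, hUy⟩ := hK.exists_subset_of_mem_open (show x ∈ ({y}ᶜ : Set K) from hxy)
    isOpen_compl_singleton
  have hU : IsClopen U := hU
  have hc : Continuous (U.indicator fun _ => (1 : ℝ)) :=
    (continuous_const (X := K) (y := (1 : ℝ))).indicator (by simp [hU.frontier_eq])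
  refine ⟨⟨⟨U.indicator fun _ => (1 : ℝ), hc⟩, ?_⟩, ?_⟩
  · refine (Set.toFinite ({0, 1} : Set ℝ)).subset ?_
    rintro _ ⟨z, rfl⟩
    by_cases hz : z ∈ U <;> simp [hz]
  · have hyU : y ∉ U := fun h => hUy h rfl
    change U.indicator (fun _ => (1 : ℝ)) x ≠ U.indicator (fun _ => (1 : ℝ)) y
    simp [hxU, hyU]

/-- The image of a separating morphism contains the characteristic functions of clopen sets. -/
theorem Hom.Separates.exists_indicator {A : WStar.{v}} {f : Hom A (contFun K)}
    (hf : f.Separates) {U : Set K} (hU : IsClopen U) :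
    ∃ a, ∀ x, f.ev a x = U.indicator (fun _ => (1 : ℝ)) x := by
  classical
  have hc : Continuous (U.indicator fun _ => (1 : ℝ)) :=
    (continuous_const (X := K) (y := (1 : ℝ))).indicator (by simp [hU.frontier_eq])
  obtain ⟨a, ha⟩ := hf.exists_approx ⟨_, hc⟩ (show (0 : ℝ) < 1 / 3 by norm_num)
  -- Since `a > 2/3` on `U` and `a < 1/3` off `U`, the function `3a - 1` is above `1` on `U` and
  -- below `0` off it. Truncation to `[0, 1]` gives the exact indicator.
  refine ⟨(((3 : ℝ) • a - A.unit) ⊔ 0) ⊓ A.unit, fun x => ?_⟩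
  have hx : |f.ev a x - U.indicator (fun _ => (1 : ℝ)) x| < 1 / 3 := ha x
  rw [f.ev_inf, f.ev_sup, f.ev_sub, f.ev_smul, f.ev_unit, f.ev_zero]
  by_cases hxU : x ∈ U
  · rw [Set.indicator_of_mem hxU] at hx ⊢
    have := (abs_lt.mp hx).1
    exact inf_eq_right.mpr (le_sup_of_le_left (by linarith))
  · rw [Set.indicator_of_notMem hxU] at hx ⊢
    have := (abs_lt.mp hx).2
    rw [sup_eq_right.mpr (by linarith), inf_eq_left.mpr zero_le_one]

/-- The image of a separating morphism contains the functions with finite range. -/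
theorem Hom.Separates.exists_eq_finRangeIncl {A : WStar.{v}} {f : Hom A (contFun K)}
    (hf : f.Separates) (g : finRange K) : ∃ a, f a = finRangeIncl K g := by
  classical
  obtain ⟨g, hg⟩ := g
  have hfin : (Set.range g).Finite := hg
  have hclopen : ∀ r : ℝ, IsClopen (g ⁻¹' {r}) := by
    intro r
    refine ⟨isClosed_singleton.preimage g.continuous, ?_⟩
    -- The fibre is open because the remaining values form a finite, hence closed, set.
    have e : g ⁻¹' {r} = g ⁻¹' (Set.range g \ {r})ᶜ := by
      ext x
      simp
    rw [e]
    exact (hfin.subset Set.sdiff_subset).isClosed.isOpen_compl.preimage g.continuous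
  choose a ha using fun r => hf.exists_indicator (hclopen r)
  refine ⟨∑ r ∈ hfin.toFinset, r • a r, Hom.ev_ext fun x => ?_⟩
  rw [f.ev_sum]
  change _ = g x
  rw [Finset.sum_eq_single (g x)]
  · rw [f.ev_smul, ha, Set.indicator_of_mem (show x ∈ g ⁻¹' {g x} from rfl), mul_one]
  · intro r _ hr
    rw [f.ev_smul, ha, Set.indicator_of_notMem (show x ∉ g ⁻¹' {r} from fun h => hr (Eq.symm h)),
      mul_zero]
  · intro h
    exact absurd (hfin.mem_toFinset.mpr ⟨x, rfl⟩) h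

/-- The order requires an essential factor, not just an inclusion of images; this is automatic
because `F(K)` is already dense in `C(K)`. -/
theorem isLeast_finRange [T2Space K] (hK : IsZeroDimensional K)
    (hF : (finRangeIncl K).IsEssential) :
    IsLeast (V (contFun K) uniformCompletion)
      (EssSub.cls ⟨finRange K, finRangeIncl K, hF⟩) := by
  have hsep := finRangeIncl_separates hK
  refine ⟨cls_mem_V hsep, fun c hc => ?_⟩
  obtain ⟨A, rfl, hA⟩ := exists_of_mem_V hc
  obtain ⟨g, hg⟩ := Hom.exists_factor A.essential.1 hA.exists_eq_finRangeIncl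
  exact EssSub.cls_le_cls.mpr
    ⟨g, hsep.isEssential_of_comp finRangeIncl_injective A.essential.1 hg, hg⟩

theorem isZeroDimensional_of_isLeast [T2Space K] {m : SubPoset (contFun K)}
    (hm : IsLeast (V (contFun K) uniformCompletion) m) : IsZeroDimensional K := by
  obtain ⟨M, rfl, hM⟩ := exists_of_mem_V hm.1
  have hloc : ∀ b, IsLocallyConstant (M.map.ev b) := by
    intro b
    rw [IsLocallyConstant.iff_eventually_eq]
    intro p
    -- The single minimum `M` is compared with a different member of `V` for each `p`, so each of
    -- its functions is constant near every point.
    have hp := constNearIncl_separates p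
    obtain ⟨g, -, hg⟩ := EssSub.cls_le_cls.mp (hm.2 (cls_mem_V
      (A := ⟨_, constNearIncl p, hp.isEssential (constNearIncl_injective p)⟩) hp))
    have e : ∀ x, M.map.ev b x = (show C(K, ℝ) from (g b).1) x := fun x => by rw [hg]; rfl
    filter_upwards [(g b).2] with x hx
    rw [e, e]
    exact hx
  have : TotallySeparatedSpace K := by
    refine totallySeparatedSpace_iff_exists_isClopen.mpr fun x y hxy => ?_
    obtain ⟨b, hb⟩ := hM x y hxy
    exact ⟨M.map.ev b ⁻¹' {M.map.ev b x}, (hloc b).isClopen_fiber _, rfl, fun h => hb (Eq.symm h)⟩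
  -- For compact Hausdorff spaces, separation of points by clopen sets yields a clopen base.
  exact isTopologicalBasis_isClopen

end ZeroDimensional

end WStar

theorem theoremu (K : Type v) [TopologicalSpace K] [CompactSpace K] [T2Space K] :
    ((∃ m : WStar.SubPoset (WStar.contFun K),
        IsLeast (WStar.V (WStar.contFun K) WStar.uniformCompletion) m) ↔ IsZeroDimensional K) ∧
    (IsZeroDimensional K →
      ∃ hF : (WStar.finRangeIncl K).IsEssential,
        IsLeast (WStar.V (WStar.contFun K) WStar.uniformCompletion)
          (WStar.EssSub.cls ⟨WStar.finRange K, WStar.finRangeIncl K, hF⟩)) := by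
  have hmin : IsZeroDimensional K →
      ∃ hF : (WStar.finRangeIncl K).IsEssential,
        IsLeast (WStar.V (WStar.contFun K) WStar.uniformCompletion)
          (WStar.EssSub.cls ⟨WStar.finRange K, WStar.finRangeIncl K, hF⟩) := fun hK =>
    have hF := (WStar.finRangeIncl_separates hK).isEssential WStar.finRangeIncl_injective
    ⟨hF, WStar.isLeast_finRange hK hF⟩
  refine ⟨⟨?_, fun hK => ?_⟩, hmin⟩
  · rintro ⟨m, hm⟩
    exact WStar.isZeroDimensional_of_isLeast hm
  · obtain ⟨hF, h⟩ := hmin hK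
    exact ⟨_, h⟩
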